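/- Let $d, m$ be the dimensions, $M\in\mathbb{R}^{d\times m}$, let $K\in\mathbb{R}^{m\times m}$ and $Q\in\mathbb{R}^{d\times d}$ be symmetric positive definite, and let $n\in\mathbb{R}$ with $n>d-1$. For $A\in\mathbb{R}^{d\times m}$ and symmetric positive definite $V\in\mathbb{R}^{d\times d}$ put $$\mathcal N_A(M,V,K)=\frac{|K|^{d/2}}{|2\pi V|^{m/2}}\exp\Bigl(-\tfrac12\operatorname{tr}\bigl((A-M)^TV^{-1}(A-M)K\bigr)\Bigr),$$ $$\mathcal{IW}_V(Q,n)=\frac1{Z_{n,d}}\,\frac1{|V|^{(d+1)/2}}\,\Bigl|\frac{V^{-1}Q}{2}\Bigr|^{n/2}\exp\Bigl(-\tfrac12\operatorname{tr}(V^{-1}Q)\Bigr),\qquad Z_{n,d}=\pi^{d(d-1)/4}\prod_{i=1}^d\Gamma\Bigl(\frac{n+1-i}2\Bigr),$$ where $|\cdot|$ is the determinant, and let $P(A,V)=\mathcal N_A(M,V,K)\,\mathcal{IW}_V(Q,n)$, extended by $0$ to symmetric $V$ that are not positive definite. Then $P$ is a probability density with respect to the Lebesgue measure $\prod_{i,j}dA_{ij}\prod_{i\le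 j}dV_{ij}$ on pairs of a $d\times m$ matrix and a symmetric $d\times d$ matrix, the function $P\ln P$ is integrable, and a random variable with density $P$ has the entropy $$-\int P\ln P\;dA\,dV=-\frac d2\ln|K|+\frac{m+d+1}2\ln|Q|+f_1(d,n),$$ where, for each fixed $m$, $f_1(d,n)$ depends only on $d$ and $n$ (and not on $M$, $K$, $Q$). -/

import Mathlib

open MeasureTheory

noncomputable section

/-- The Borel (product) σ-algebra on real matrices. -/
instance matrixMeasurableSpace (d m : ℕ) : MeasurableSpace (Matrix (Fin d) (Fin m) ℝ) :=
  inferInstanceAs (MeasurableSpace (Fin d → Fin m → ℝ))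

/-- Lebesgue measure `dA = ∏ i j, dA i j` on real `d × m` matrices. -/
def matrixVolume (d m : ℕ) : Measure (Matrix (Fin d) (Fin m) ℝ) :=
  (volume : Measure (Fin d → Fin m → ℝ)).map Matrix.of

/-- The symmetric `d × d` matrix whose entries on and above the diagonal are given by `v`. -/
def symMatrix (d : ℕ) (v : {p : Fin d × Fin d // p.1 ≤ p.2} → ℝ) : Matrix (Fin d) (Fin d) ℝ :=
  Matrix.of fun i j => v ⟨(min i j, max i j), min_le_max⟩

/-- Lebesgue measure `dV = ∏ i ≤ j, dV i j` on the space of real symmetric `d × d` matrices,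
regarded as a measure on all `d × d` matrices that is carried by the symmetric ones. -/
def symMatrixVolume (d : ℕ) : Measure (Matrix (Fin d) (Fin d) ℝ) :=
  (volume : Measure ({p : Fin d × Fin d // p.1 ≤ p.2} → ℝ)).map (symMatrix d)

/-- The matrix normal density `N_A(M, V, K)`: mean `M`, row covariance `V`, precision `K`. -/
def matrixNormalDensity {d m : ℕ} (M : Matrix (Fin d) (Fin m) ℝ) (V : Matrix (Fin d) (Fin d) ℝ)
    (K : Matrix (Fin m) (Fin m) ℝ) (A : Matrix (Fin d) (Fin m) ℝ) : ℝ :=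
  K.det ^ ((d : ℝ) / 2) / ((2 * Real.pi) • V).det ^ ((m : ℝ) / 2) *
    Real.exp (-(1 / 2) * ((A - M).transpose * V⁻¹ * (A - M) * K).trace)

/-- `Z_{n,d} = π ^ (d (d - 1) / 4) ∏_{i=1}^d Γ((n + 1 - i) / 2)`. -/
def wishartZ (n : ℝ) (d : ℕ) : ℝ :=
  Real.pi ^ ((d : ℝ) * ((d : ℝ) - 1) / 4) *
    ∏ i ∈ Finset.Icc 1 d, Real.Gamma ((n + 1 - (i : ℝ)) / 2)

open Classical in
/-- The inverted Wishart density `IW_V(Q, n)`; it is supported on the positive definite `V`. -/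
def invWishartDensity {d : ℕ} (Q : Matrix (Fin d) (Fin d) ℝ) (n : ℝ)
    (V : Matrix (Fin d) (Fin d) ℝ) : ℝ :=
  if V.PosDef then
    1 / wishartZ n d * (1 / V.det ^ (((d : ℝ) + 1) / 2)) *
      ((1 / 2 : ℝ) • (V⁻¹ * Q)).det ^ (n / 2) * Real.exp (-(1 / 2) * (V⁻¹ * Q).trace)
  else 0

/-- The joint density `P(A, V) = N_A(M, V, K) IW_V(Q, n)`. -/
def jointDensity {d m : ℕ} (M : Matrix (Fin d) (Fin m) ℝ) (K : Matrix (Fin m) (Fin m) ℝ)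
    (Q : Matrix (Fin d) (Fin d) ℝ) (n : ℝ)
    (θ : Matrix (Fin d) (Fin m) ℝ × Matrix (Fin d) (Fin d) ℝ) : ℝ :=
  matrixNormalDensity M θ.2 K θ.1 * invWishartDensity Q n θ.2

/-- `p` is a probability density with respect to `μ`. -/
def IsProbDensity {E : Type*} [MeasurableSpace E] (μ : Measure E) (p : E → ℝ) : Prop :=
  Measurable p ∧ (∀ x, 0 ≤ p x) ∧ ∫⁻ x, ENNReal.ofReal (p x) ∂μ = 1

/-- A random variable with density `p` with respect to `μ` has (differential) entropy `h`, in nats: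
the integral `-∫ p ln p dμ` exists and equals `h`. -/
def HasEntropy {E : Type*} [MeasurableSpace E] (μ : Measure E) (p : E → ℝ) (h : ℝ) : Prop :=
  Integrable (fun x => p x * Real.log (p x)) μ ∧ -∫ x, p x * Real.log (p x) ∂μ = h

end

/-! All the densities form one orbit. With `Q = L Lᵀ`, `K = S Sᵀ` and `R = S⁻¹`, the map `(A, V) ↦
(L A R + M, L V Lᵀ)` carries the standard density (`M = 0`, `K = 1`, `Q = 1`) to the general one.
Its Jacobian is constant: `|det L|^m |det R|^d` on the rectangular part (`det_mulLeftRight`) and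
`|det L|^(d+1)` on the symmetric part (`det_symConj`). A change of variables with constant Jacobian
adds the logarithm of the Jacobian to the entropy (`IsProbDensity.hasEntropy_of_map`). Since `log
|det L| = ½ log |Q|` and `log |det R| = -½ log |K|`, the shift is exactly the explicit part of the
formula, and `f₁` is the entropy of the standard density.

It remains to treat the standard density. Integrating out `A` is a Gaussian integral and leaves an
inverted Wishart integral, evaluated by induction on `d` (`lintegral_invWishartKernel`): in Schur
complement coordinates a bordered matrix splits into its lower block, a Gaussian vector and an
inverse gamma variable.

For integrability of `P log P`, `|x log x|` is bounded by a multiple of `x^(1+ε) + x^(1-ε)`, and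
powers of the kernel are kernels of the same family with scaled `r` and `β`. This is why the
integrals are computed for general `β` and not only for `β = 1`. -/

instance matrixBorelSpace (d m : ℕ) : BorelSpace (Matrix (Fin d) (Fin m) ℝ) :=
  inferInstanceAs (BorelSpace (Fin d → Fin m → ℝ))

/-! ### Symmetric matrices in coordinates, and the Jacobian of `V ↦ L V Lᵀ`. -/

theorem symMatrix_transpose (d : ℕ) (v : {p : Fin d × Fin d // p.1 ≤ p.2} → ℝ) :
    (symMatrix d v).transpose = symMatrix d v := by
  ext i j
  simp [symMatrix, min_comm, max_comm]

theorem symMatrix_upper {d : ℕ} {S : Matrix (Fin d) (Fin d) ℝ} (hS : S.transpose = S) :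
    symMatrix d (fun p => S p.1.1 p.1.2) = S := by
  ext i j
  rcases le_total i j with h | h
  · simp [symMatrix, h]
  · have := congrFun (congrFun hS i) j
    simpa [symMatrix, h] using this

theorem measurable_symMatrix (d : ℕ) : Measurable (symMatrix d) := by
  refine measurable_pi_iff.2 fun i => measurable_pi_iff.2 fun j => ?_
  exact measurable_pi_apply _

/-- The action `S ↦ L S Lᵀ` of square matrices on symmetric matrices, in the coordinates given by
the entries on and above the diagonal. -/
noncomputable def symConj (d : ℕ) : Matrix (Fin d) (Fin d) ℝ →*
    Module.End ℝ ({p : Fin d × Fin d // p.1 ≤ p.2} → ℝ) where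
  toFun L :=
    { toFun := fun v p => (L * symMatrix d v * L.transpose) p.1.1 p.1.2
      map_add' := fun v w => by
        have : symMatrix d (v + w) = symMatrix d v + symMatrix d w := rfl
        ext p
        simp [this, Matrix.mul_add, Matrix.add_mul]
      map_smul' := fun c v => by
        have : symMatrix d (c • v) = c • symMatrix d v := rfl
        ext p
        simp [this] }
  map_one' := by
    ext v p
    simp [symMatrix, p.2]
  map_mul' L N := by
    refine LinearMap.ext fun v => funext fun p => ?_
    have h : symMatrix d (fun p => (N * symMatrix d v * N.transpose) p.1.1 p.1.2)
        = N * symMatrix d v * N.transpose := by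
      apply symMatrix_upper
      simp [Matrix.transpose_mul, symMatrix_transpose, Matrix.mul_assoc]
    simp only [LinearMap.coe_mk, AddHom.coe_mk, Module.End.mul_apply, h]
    simp only [Matrix.transpose_mul, Matrix.mul_assoc]

theorem symMatrix_symConj {d : ℕ} (L : Matrix (Fin d) (Fin d) ℝ)
    (v : {p : Fin d × Fin d // p.1 ≤ p.2} → ℝ) :
    symMatrix d (symConj d L v) = L * symMatrix d v * L.transpose := by
  refine symMatrix_upper (S := L * symMatrix d v * L.transpose) ?_
  simp [Matrix.transpose_mul, symMatrix_transpose, Matrix.mul_assoc]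

/-- Counting from zero, the index `i` is the row of `d - i` pairs and the column of `i + 1` pairs,
so each `D i` occurs `d + 1` times. -/
theorem prod_upper_mul (d : ℕ) (D : Fin d → ℝ) :
    ∏ p : {p : Fin d × Fin d // p.1 ≤ p.2}, (D p.1.1 * D p.1.2) = (∏ i, D i) ^ (d + 1) := by
  have key : ∀ f : Fin d × Fin d → ℝ, ∏ p : {p : Fin d × Fin d // p.1 ≤ p.2}, f p.1
      = ∏ i, ∏ j, if i ≤ j then f (i, j) else 1 := by
    intro f
    rw [← Fintype.prod_prod_type' (f := fun i j => if i ≤ j then f (i, j) else 1),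
      ← Finset.prod_filter]
    exact (Finset.prod_subtype _ (by simp) _).symm
  rw [Finset.prod_mul_distrib, key (fun p => D p.1), key (fun p => D p.2),
    Finset.prod_comm (f := fun i j => if i ≤ j then D (i, j).2 else 1), ← Finset.prod_mul_distrib,
    ← Finset.prod_pow]
  refine Finset.prod_congr rfl fun i _ => ?_
  simp only [← Finset.prod_filter, Finset.prod_const, ← pow_add]
  congr 1
  have h1 : (Finset.univ.filter fun j : Fin d => i ≤ j) = Finset.Ici i := by ext; simp
  have h2 : (Finset.univ.filter fun j : Fin d => j ≤ i) = Finset.Iic i := by ext; simp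
  rw [h1, h2, Fin.card_Ici, Fin.card_Iic]
  omega

theorem det_symConj_diagonal {d : ℕ} (D : Fin d → ℝ) :
    LinearMap.det (symConj d (Matrix.diagonal D)) = (Matrix.diagonal D).det ^ (d + 1) := by
  have : symConj d (Matrix.diagonal D)
      = Matrix.toLin' (Matrix.diagonal fun p => D p.1.1 * D p.1.2) := by
    refine LinearMap.ext fun v => funext fun p => ?_
    simp [symConj, Matrix.mulVec_diagonal, symMatrix, p.2]
    ring
  rw [this, LinearMap.det_toLin', Matrix.det_diagonal, Matrix.det_diagonal, prod_upper_mul]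

/-- A transvection is thus conjugate to its own square, which forces its image under a determinant
to be `1`. -/
theorem diagonal_mul_transvection {d : ℕ} {i j : Fin d} (hij : i ≠ j) (c : ℝ) :
    Matrix.diagonal (Function.update (fun _ => (1 : ℝ)) i 2) * Matrix.transvection i j c
      = Matrix.transvection i j (c + c) *
        Matrix.diagonal (Function.update (fun _ => (1 : ℝ)) i 2) := by
  ext a b
  rw [Matrix.diagonal_mul, Matrix.mul_diagonal]
  simp only [Matrix.transvection, Matrix.add_apply, Matrix.one_apply, Matrix.single_apply,
    Function.update_apply]
  split_ifs <;> first | grind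

/-- Both sides are multiplicative in `L`, so diagonal matrices and transvections suffice. For a
transvection the determinant `t` satisfies `t = t * t` by conjugacy with the square, and `t` is
invertible. -/
theorem det_symConj {d : ℕ} (L : Matrix (Fin d) (Fin d) ℝ) (hL : L.det ≠ 0) :
    LinearMap.det (symConj d L) = L.det ^ (d + 1) := by
  refine Matrix.diagonal_transvection_induction_of_det_ne_zero
    (fun L => LinearMap.det (symConj d L) = L.det ^ (d + 1)) L hL
    (fun D _ => det_symConj_diagonal D) (fun t => ?_) fun A B _ _ ihA ihB => ?_
  · obtain ⟨i, j, hij, c⟩ := t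
    rw [Matrix.TransvectionStruct.det, one_pow, Matrix.TransvectionStruct.toMatrix_mk]
    have h1 := congrArg (fun A => LinearMap.det (symConj d A)) (diagonal_mul_transvection hij c)
    have h2 : LinearMap.det (symConj d (Matrix.transvection i j c)) *
        LinearMap.det (symConj d (Matrix.transvection i j (-c))) = 1 := by
      rw [← map_mul, ← map_mul, Matrix.transvection_mul_transvection_same i j hij]
      simp
    have h3 : LinearMap.det (symConj d
        (Matrix.diagonal (Function.update (fun _ => (1 : ℝ)) i 2))) ≠ 0 := by
      rw [det_symConj_diagonal, Matrix.det_diagonal]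
      refine pow_ne_zero _ (Finset.prod_ne_zero_iff.2 fun k _ => ?_)
      rw [Function.update_apply]
      split_ifs <;> norm_num
    simp only [map_mul, ← Matrix.transvection_mul_transvection_same i j hij] at h1
    have h4 := mul_left_cancel₀ h3 (h1.trans (mul_comm _ _))
    exact (mul_right_cancel₀ (left_ne_zero_of_mul_eq_one h2) ((one_mul _).trans h4)).symm
  · rw [map_mul, map_mul, ihA, ihB, Matrix.det_mul, mul_pow]

theorem measurable_conj {d : ℕ} (L : Matrix (Fin d) (Fin d) ℝ) :
    Measurable fun V : Matrix (Fin d) (Fin d) ℝ => L * V * L.transpose :=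
  Continuous.measurable (by fun_prop)

theorem map_conj_symMatrixVolume {d : ℕ} (L : Matrix (Fin d) (Fin d) ℝ) (hL : L.det ≠ 0) :
    (symMatrixVolume d).map (fun V => L * V * L.transpose)
      = ENNReal.ofReal ((|L.det| ^ (d + 1))⁻¹) • symMatrixVolume d := by
  have hdet : LinearMap.det (symConj d L) ≠ 0 := by
    rw [det_symConj L hL]; exact pow_ne_zero _ hL
  have h := Measure.map_linearMap_addHaar_eq_smul_addHaar volume hdet
  rw [symMatrixVolume, Measure.map_map (measurable_conj L) (measurable_symMatrix d)]
  have hc : (fun V => L * V * L.transpose) ∘ symMatrix d = symMatrix d ∘ symConj d L :=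
    funext fun v => (symMatrix_symConj L v).symm
  rw [hc, ← Measure.map_map (measurable_symMatrix d)
    (LinearMap.continuous_of_finiteDimensional _).measurable, h, Measure.map_smul,
    det_symConj L hL, abs_inv, abs_pow]

/-! ### Affine maps of rectangular matrices. -/

/-- The linear map `A ↦ L A R` on families of real numbers indexed by rows and columns. -/
def mulLeftRight {d m : ℕ} (L : Matrix (Fin d) (Fin d) ℝ) (R : Matrix (Fin m) (Fin m) ℝ) :
    (Fin d → Fin m → ℝ) →ₗ[ℝ] (Fin d → Fin m → ℝ) where
  toFun A := L * Matrix.of A * R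
  map_add' A B := by
    change L * (Matrix.of A + Matrix.of B) * R = L * Matrix.of A * R + L * Matrix.of B * R
    rw [Matrix.mul_add, Matrix.add_mul]
  map_smul' c A := by
    change L * (c • Matrix.of A) * R = c • (L * Matrix.of A * R)
    rw [Matrix.mul_smul, Matrix.smul_mul]

/-- Vectorization of matrices as a linear equivalence. -/
def vecEquiv (d m : ℕ) : (Fin d → Fin m → ℝ) ≃ₗ[ℝ] (Fin m × Fin d → ℝ) where
  toFun A p := A p.2 p.1
  invFun v i j := v (j, i)
  map_add' _ _ := rfl
  map_smul' _ _ := rfl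

/-- Stacking columns turns the map into the Kronecker product of `Rᵀ` and `L`. -/
theorem det_mulLeftRight {d m : ℕ} (L : Matrix (Fin d) (Fin d) ℝ) (R : Matrix (Fin m) (Fin m) ℝ) :
    LinearMap.det (mulLeftRight L R) = L.det ^ m * R.det ^ d := by
  rw [← LinearMap.det_conj (mulLeftRight L R) (vecEquiv d m)]
  have : (vecEquiv d m : (Fin d → Fin m → ℝ) →ₗ[ℝ] _) ∘ₗ mulLeftRight L R ∘ₗ
      ((vecEquiv d m).symm : _ →ₗ[ℝ] (Fin d → Fin m → ℝ))
      = Matrix.toLin' (Matrix.kroneckerMap (· * ·) R.transpose L) := by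
    refine LinearMap.ext fun v => ?_
    have h := Matrix.kronecker_mulVec_vec L (Matrix.of ((vecEquiv d m).symm v)) R.transpose
    rw [Matrix.transpose_transpose] at h
    exact h.symm
  rw [this, LinearMap.det_toLin', Matrix.det_kronecker]
  simp [mul_comm]

theorem map_affine_matrixVolume {d m : ℕ} (M : Matrix (Fin d) (Fin m) ℝ)
    (L : Matrix (Fin d) (Fin d) ℝ) (R : Matrix (Fin m) (Fin m) ℝ)
    (hL : L.det ≠ 0) (hR : R.det ≠ 0) :
    (matrixVolume d m).map (fun A => L * A * R + M)
      = ENNReal.ofReal ((|L.det| ^ m * |R.det| ^ d)⁻¹) • matrixVolume d m := by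
  obtain ⟨M', hM⟩ : ∃ M' : Fin d → Fin m → ℝ, M = Matrix.of M' := ⟨M, rfl⟩
  have hdet : LinearMap.det (mulLeftRight L R) ≠ 0 := by
    rw [det_mulLeftRight]; exact mul_ne_zero (pow_ne_zero _ hL) (pow_ne_zero _ hR)
  have h := Measure.map_linearMap_addHaar_eq_smul_addHaar
    (volume : Measure (Fin d → Fin m → ℝ)) hdet
  have h2 : Measure.map (fun A => A + M')
      (volume : Measure (Fin d → Fin m → ℝ)) = volume := map_add_right_eq_self _ _
  have hv : matrixVolume d m = (volume : Measure (Fin d → Fin m → ℝ)) := Measure.map_id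
  rw [hv, hM]
  have hc : (fun A : Matrix (Fin d) (Fin m) ℝ => L * A * R + Matrix.of M')
      = (fun A => A + M') ∘ mulLeftRight L R := rfl
  have hm : Measurable (mulLeftRight L R) :=
    (LinearMap.continuous_of_finiteDimensional _).measurable
  have h3 := Measure.map_map (μ := (volume : Measure (Fin d → Fin m → ℝ)))
    (measurable_add_const M') hm
  rw [h, Measure.map_smul, h2, det_mulLeftRight, abs_inv, abs_mul, abs_pow, abs_pow] at h3
  exact h3.symm

/-! ### Gaussian and inverse gamma integrals. -/

/-- The Bochner integral of a non-integrable function is `0`, so a closed formula with nonzero value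
already contains integrability. -/
theorem lintegral_ofReal_eq_of_integral_ne_zero {α : Type*} [MeasurableSpace α] {μ : Measure α}
    {f : α → ℝ} (hf : 0 ≤ᵐ[μ] f) (h : ∫ x, f x ∂μ ≠ 0) :
    ∫⁻ x, ENNReal.ofReal (f x) ∂μ = ENNReal.ofReal (∫ x, f x ∂μ) :=
  (ofReal_integral_eq_lintegral_ofReal (Integrable.of_integral_ne_zero h) hf).symm

theorem Matrix.PosDef.exists_mul_transpose {d : ℕ} {V : Matrix (Fin d) (Fin d) ℝ}
    (hV : V.PosDef) : ∃ L : Matrix (Fin d) (Fin d) ℝ, L.det ≠ 0 ∧ V = L * L.transpose := by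
  open scoped MatrixOrder in
  have h0 : 0 ≤ V := hV.posSemidef.nonneg
  have hs := CFC.sqrt_mul_sqrt_self V h0
  have hh : (CFC.sqrt V).IsHermitian :=
    (Matrix.nonneg_iff_posSemidef.1 (CFC.sqrt_nonneg V)).isHermitian
  have ht : (CFC.sqrt V).transpose = CFC.sqrt V := by
    rwa [Matrix.IsHermitian, Matrix.conjTranspose_eq_transpose_of_trivial] at hh
  refine ⟨CFC.sqrt V, fun h => hV.det_pos.ne' ?_, by rw [ht, hs]⟩
  rw [← hs, Matrix.det_mul, h, zero_mul]

theorem integral_gaussian_pi (d : ℕ) (b : ℝ) :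
    ∫ x : Fin d → ℝ, Real.exp (-b * (x ⬝ᵥ x)) = √(Real.pi / b) ^ d := by
  have h := integral_fintype_prod_volume_eq_pow (ι := Fin d) (fun t : ℝ => Real.exp (-b * t ^ 2))
  rw [integral_gaussian, Fintype.card_fin] at h
  rw [← h]
  congr 1 with x
  rw [← Real.exp_sum, ← Finset.mul_sum, dotProduct]
  simp only [pow_two]

theorem lintegral_gaussian_pi (d : ℕ) {b : ℝ} (hb : 0 < b) :
    ∫⁻ x : Fin d → ℝ, ENNReal.ofReal (Real.exp (-b * (x ⬝ᵥ x)))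
      = ENNReal.ofReal (√(Real.pi / b) ^ d) := by
  rw [← integral_gaussian_pi]
  refine lintegral_ofReal_eq_of_integral_ne_zero (.of_forall fun x => (Real.exp_pos _).le) ?_
  rw [integral_gaussian_pi]
  positivity

theorem integral_gaussian_matrix (d m : ℕ) (b : ℝ) :
    ∫ A, Real.exp (-b * (A.transpose * A).trace) ∂(matrixVolume d m)
      = √(Real.pi / b) ^ (m * d) := by
  have hv : matrixVolume d m = (volume : Measure (Fin d → Fin m → ℝ)) := Measure.map_id
  have h := integral_fintype_prod_volume_eq_pow (ι := Fin d)
    (fun x : Fin m → ℝ => Real.exp (-b * (x ⬝ᵥ x)))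
  rw [integral_gaussian_pi, Fintype.card_fin, ← pow_mul] at h
  rw [hv, ← h]
  refine integral_congr_ae (.of_forall fun A => ?_)
  dsimp only
  rw [← Real.exp_sum, ← Finset.mul_sum]
  congr 2
  simp only [Matrix.trace, Matrix.diag, Matrix.mul_apply, Matrix.transpose_apply, dotProduct]
  exact Finset.sum_comm

/-- Write `V = L Lᵀ` and substitute `L A` for `A`; the Jacobian `|det L|^m` is the power of `det V`.
-/
theorem lintegral_gaussian_matrix {d : ℕ} (m : ℕ) {b : ℝ} (hb : 0 < b)
    {V : Matrix (Fin d) (Fin d) ℝ} (hV : V.PosDef) :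
    ∫⁻ A, ENNReal.ofReal (Real.exp (-b * (A.transpose * V⁻¹ * A).trace)) ∂(matrixVolume d m)
      = ENNReal.ofReal (V.det ^ ((m : ℝ) / 2) * √(Real.pi / b) ^ (m * d)) := by
  obtain ⟨L, hL, rfl⟩ := hV.exists_mul_transpose
  have hu : IsUnit L.det := isUnit_iff_ne_zero.2 hL
  have hut : IsUnit L.transpose.det := by rwa [Matrix.det_transpose]
  have hmap := map_affine_matrixVolume 0 L (1 : Matrix (Fin m) (Fin m) ℝ) hL (by simp)
  simp only [add_zero, Matrix.mul_one, Matrix.det_one, abs_one, one_pow, mul_one] at hmap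
  set F : Matrix (Fin d) (Fin m) ℝ → ENNReal := fun A =>
    ENNReal.ofReal (Real.exp (-b * (A.transpose * (L * L.transpose)⁻¹ * A).trace))
  have hF : Measurable F := by
    refine ENNReal.measurable_ofReal.comp (Real.measurable_exp.comp (Continuous.measurable ?_))
    fun_prop
  have hFL : ∀ A : Matrix (Fin d) (Fin m) ℝ, F (L * A)
      = ENNReal.ofReal (Real.exp (-b * (A.transpose * A).trace)) := by
    intro A
    have : (L * A).transpose * (L * L.transpose)⁻¹ * (L * A) = A.transpose * A := by
      rw [Matrix.mul_inv_rev, Matrix.transpose_mul]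
      calc _ = A.transpose * (L.transpose * L.transpose⁻¹) * (L⁻¹ * L) * A := by
            simp only [Matrix.mul_assoc]
        _ = _ := by rw [Matrix.mul_nonsing_inv _ hut, Matrix.nonsing_inv_mul _ hu]; simp
    simp only [F, this]
  have h1 : ∫⁻ A, F A ∂((matrixVolume d m).map (fun A => L * A))
      = ENNReal.ofReal (√(Real.pi / b) ^ (m * d)) := by
    rw [lintegral_map hF (Continuous.measurable (by fun_prop)), ← integral_gaussian_matrix]
    simp only [hFL]
    refine lintegral_ofReal_eq_of_integral_ne_zero (.of_forall fun x => (Real.exp_pos _).le) ?_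
    rw [integral_gaussian_matrix]
    positivity
  rw [hmap, lintegral_smul_measure] at h1
  have hpos : 0 < |L.det| ^ m := by positivity
  have hd : (L * L.transpose).det ^ ((m : ℝ) / 2) = |L.det| ^ m := by
    rw [Matrix.det_mul, Matrix.det_transpose, ← abs_mul_abs_self, ← pow_two,
      ← Real.rpow_natCast_mul (abs_nonneg _)]
    push_cast
    rw [mul_div_cancel₀ _ (two_ne_zero), Real.rpow_natCast]
  rw [hd, ENNReal.ofReal_mul hpos.le, ← h1, smul_eq_mul, ← mul_assoc,
    ← ENNReal.ofReal_mul hpos.le, mul_inv_cancel₀ hpos.ne', ENNReal.ofReal_one, one_mul]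

/-- The substitution `t = 1 / s` gives the Gamma integral. -/
theorem lintegral_inverse_gamma {a c : ℝ} (ha : 0 < a) (hc : 0 < c) :
    ∫⁻ s in Set.Ioi (0 : ℝ), ENNReal.ofReal (s ^ (-(a + 1)) * Real.exp (-c / s))
      = ENNReal.ofReal ((1 / c) ^ a * Real.Gamma a) := by
  have h := integral_comp_rpow_Ioi (fun t : ℝ => t ^ (a - 1) * Real.exp (-(c * t)))
    (p := -1) (by norm_num)
  rw [Real.integral_rpow_mul_exp_neg_mul_Ioi ha hc] at h
  have h2 : ∫ s in Set.Ioi (0 : ℝ), s ^ (-(a + 1)) * Real.exp (-c / s)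
      = (1 / c) ^ a * Real.Gamma a := by
    rw [← h]
    refine setIntegral_congr_fun measurableSet_Ioi fun s hs => ?_
    have hs : 0 < s := hs
    simp only [smul_eq_mul, abs_neg, abs_one, one_mul]
    rw [← Real.rpow_mul hs.le, ← mul_assoc, ← Real.rpow_add hs, Real.rpow_neg_one]
    congr 2
    · ring
    · field_simp
  rw [← h2]
  refine lintegral_ofReal_eq_of_integral_ne_zero
    ((ae_restrict_mem measurableSet_Ioi).mono fun s hs => ?_) ?_
  · have hs : 0 < s := hs
    positivity
  · rw [h2]
    have := Real.Gamma_pos_of_pos ha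
    positivity

/-! ### Measurability of the determinant, the inverse and the positive definite cone. -/

theorem measurable_matrix_det (d : ℕ) : Measurable fun V : Matrix (Fin d) (Fin d) ℝ => V.det :=
  Continuous.measurable (by fun_prop)

theorem measurable_matrix_inv (d : ℕ) : Measurable fun V : Matrix (Fin d) (Fin d) ℝ => V⁻¹ := by
  have : (fun V : Matrix (Fin d) (Fin d) ℝ => V⁻¹) = fun V => V.det⁻¹ • V.adjugate := by
    ext V
    rw [Matrix.inv_def, Ring.inverse_eq_inv']
  rw [this]
  refine measurable_pi_iff.2 fun i => measurable_pi_iff.2 fun j => ?_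
  refine (measurable_matrix_det d).inv.mul (Continuous.measurable ?_)
  exact (continuous_id.matrix_adjugate).matrix_elem i j

theorem measurableSet_posDef (d : ℕ) :
    MeasurableSet {V : Matrix (Fin d) (Fin d) ℝ | V.PosDef} := by
  -- The semidefinite cone is closed, as an intersection of closed conditions even over uncountably
  -- many `x`; removing `det = 0` leaves the definite matrices.
  have h : {V : Matrix (Fin d) (Fin d) ℝ | V.PosDef}
      = ({V | V.transpose = V} ∩ ⋂ x : Fin d → ℝ, {V | 0 ≤ x ⬝ᵥ V.mulVec x})
        ∩ {V | V.det ≠ 0} := by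
    ext V
    simp only [Set.mem_ofPred_eq, Set.mem_inter_iff, Set.mem_iInter]
    constructor
    · intro hV
      refine ⟨⟨?_, fun x => ?_⟩, hV.det_pos.ne'⟩
      · have := hV.isHermitian
        rwa [Matrix.IsHermitian, Matrix.conjTranspose_eq_transpose_of_trivial] at this
      · simpa using hV.posSemidef.dotProduct_mulVec_nonneg x
    · rintro ⟨⟨h1, h2⟩, h3⟩
      have : V.PosSemidef := by
        refine .of_dotProduct_mulVec_nonneg ?_ fun x => by simpa using h2 x
        rwa [Matrix.IsHermitian, Matrix.conjTranspose_eq_transpose_of_trivial]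
      exact (Matrix.PosSemidef.posDef_iff_det_ne_zero this).2 h3
  rw [h]
  refine MeasurableSet.inter (IsClosed.measurableSet (IsClosed.inter ?_ ?_)) ?_
  · exact isClosed_eq (by fun_prop) continuous_id
  · exact isClosed_iInter fun x => isClosed_le continuous_const (by fun_prop)
  · exact measurableSet_eq_fun (measurable_matrix_det d) measurable_const |>.compl

/-! ### Bordered matrices and the splitting of the symmetric volume. -/

/-- The symmetric matrix `[[a, bᵀ], [b, C]]`. -/
def borderMatrix {d : ℕ} (a : ℝ) (b : Fin d → ℝ) (C : Matrix (Fin d) (Fin d) ℝ) :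
    Matrix (Fin (d + 1)) (Fin (d + 1)) ℝ :=
  Matrix.of (Fin.cons (Fin.cons a b) fun i => Fin.cons (b i) (C i))

theorem measurable_borderMatrix (d : ℕ) :
    Measurable fun q : Matrix (Fin d) (Fin d) ℝ × (Fin d → ℝ) × ℝ =>
      borderMatrix q.2.2 q.2.1 q.1 := by
  refine measurable_pi_iff.2 fun i => measurable_pi_iff.2 fun j => ?_
  have hC : ∀ i j, Measurable fun q : Matrix (Fin d) (Fin d) ℝ × (Fin d → ℝ) × ℝ => q.1 i j :=
    fun i j => (measurable_pi_apply j).comp ((measurable_pi_apply i).comp measurable_fst)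
  refine Fin.cases ?_ (fun i => ?_) i <;> refine Fin.cases ?_ (fun j => ?_) j <;>
    simp only [borderMatrix, Matrix.of_apply, Fin.cons_zero, Fin.cons_succ]
  · fun_prop
  · fun_prop
  · fun_prop
  · exact hC i j

/-- The positions on and above the diagonal of a square matrix of size `d + 1`: those of the lower
right block of size `d`, the rest of the first row, and the corner. -/
noncomputable def upperSuccEquiv (d : ℕ) :
    {p : Fin d × Fin d // p.1 ≤ p.2} ⊕ (Fin d ⊕ Unit)
      ≃ {p : Fin (d + 1) × Fin (d + 1) // p.1 ≤ p.2} :=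
  Equiv.ofBijective
    (Sum.elim (fun p => ⟨(p.1.1.succ, p.1.2.succ), Fin.succ_le_succ_iff.2 p.2⟩)
      (Sum.elim (fun j => ⟨(0, j.succ), Fin.zero_le _⟩) fun _ => ⟨(0, 0), le_rfl⟩)) <| by
    constructor
    · rintro (⟨⟨i, j⟩, h⟩ | j | _) (⟨⟨i', j'⟩, h'⟩ | j' | _) <;>
        simp [Fin.succ_ne_zero, (Fin.succ_ne_zero _).symm]
    · rintro ⟨⟨i, j⟩, h⟩
      induction i using Fin.cases with
      | zero =>
        induction j using Fin.cases with
        | zero => exact ⟨.inr (.inr ()), rfl⟩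
        | succ j => exact ⟨.inr (.inl j), rfl⟩
      | succ i =>
        induction j using Fin.cases with
        | zero => exact absurd h (by simp)
        | succ j => exact ⟨.inl ⟨(i, j), Fin.succ_le_succ_iff.1 h⟩, rfl⟩

theorem symMatrix_upperSuccEquiv {d : ℕ}
    (w : {p : Fin d × Fin d // p.1 ≤ p.2} ⊕ (Fin d ⊕ Unit) → ℝ) :
    symMatrix (d + 1) (MeasurableEquiv.piCongrLeft (fun _ => ℝ) (upperSuccEquiv d) w)
      = borderMatrix (w (.inr (.inr ()))) (fun j => w (.inr (.inl j)))
        (symMatrix d fun p => w (.inl p)) := by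
  have key : ∀ q, MeasurableEquiv.piCongrLeft (fun _ => ℝ) (upperSuccEquiv d) w
      (upperSuccEquiv d q) = w q := fun q => Equiv.piCongrLeft_apply_apply _ _ _ _
  ext i j
  refine Fin.cases ?_ (fun i => ?_) i <;> refine Fin.cases ?_ (fun j => ?_) j <;>
    simp only [borderMatrix, symMatrix, Matrix.of_apply, Fin.cons_zero, Fin.cons_succ]
  · exact key (.inr (.inr ()))
  · exact key (.inr (.inl j))
  · exact key (.inr (.inl i))
  · rw [← key]
    refine congrArg _ (Subtype.ext ?_)
    rcases le_total i j with h | h <;> simp [upperSuccEquiv, h] <;> rfl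

theorem lintegral_symMatrixVolume_succ (d : ℕ)
    {f : Matrix (Fin (d + 1)) (Fin (d + 1)) ℝ → ENNReal} (hf : Measurable f) :
    ∫⁻ V, f V ∂(symMatrixVolume (d + 1))
      = ∫⁻ C, (∫⁻ b : Fin d → ℝ, ∫⁻ a : ℝ, f (borderMatrix a b C)) ∂(symMatrixVolume d) := by
  have hg : Measurable fun q : Matrix (Fin d) (Fin d) ℝ × (Fin d → ℝ) × ℝ =>
      f (borderMatrix q.2.2 q.2.1 q.1) := hf.comp (measurable_borderMatrix d)
  have e1 := volume_measurePreserving_piCongrLeft (fun _ => ℝ) (upperSuccEquiv d)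
  have e2 := (volume_measurePreserving_sumPiEquivProdPi_symm
    (fun _ : {p : Fin d × Fin d // p.1 ≤ p.2} ⊕ (Fin d ⊕ Unit) => ℝ))
  have e3 := (volume_measurePreserving_sumPiEquivProdPi_symm (fun _ : Fin d ⊕ Unit => ℝ))
  have e4 := (volume_preserving_funUnique Unit ℝ).symm
  have e5 := (MeasurePreserving.id (volume : Measure (Fin d → ℝ))).prod e4
  have e6 := (MeasurePreserving.id
    (volume : Measure ({p : Fin d × Fin d // p.1 ≤ p.2} → ℝ))).prod (e3.comp e5)
  have e7 := e1.comp (e2.comp e6)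
  rw [symMatrixVolume, lintegral_map hf (measurable_symMatrix _)]
  refine (e7.lintegral_comp (hf.comp (measurable_symMatrix _))).symm.trans ?_
  rw [symMatrixVolume, lintegral_map (by
    exact Measurable.lintegral_prod_right' (ν := (volume : Measure (Fin d → ℝ)))
      (f := fun q : Matrix (Fin d) (Fin d) ℝ × (Fin d → ℝ) =>
        ∫⁻ a : ℝ, f (borderMatrix a q.2 q.1))
      (Measurable.lintegral_prod_right' (ν := (volume : Measure ℝ))
        (f := fun q : (Matrix (Fin d) (Fin d) ℝ × (Fin d → ℝ)) × ℝ =>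
          f (borderMatrix q.2 q.1.2 q.1.1)) (hg.comp (f :=
          fun q : (Matrix (Fin d) (Fin d) ℝ × (Fin d → ℝ)) × ℝ => (q.1.1, q.1.2, q.2)) (by fun_prop)))) (measurable_symMatrix d)]
  have hh : Measurable fun q : ({p : Fin d × Fin d // p.1 ≤ p.2} → ℝ) × (Fin d → ℝ) × ℝ =>
      f (borderMatrix q.2.2 q.2.1 (symMatrix d q.1)) :=
    hg.comp (((measurable_symMatrix d).comp measurable_fst).prodMk measurable_snd)
  have hcomp : ∀ q : ({p : Fin d × Fin d // p.1 ≤ p.2} → ℝ) × (Fin d → ℝ) × ℝ,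
      f (symMatrix (d + 1) (MeasurableEquiv.piCongrLeft (fun _ => ℝ) (upperSuccEquiv d)
        ((MeasurableEquiv.sumPiEquivProdPi _).symm (q.1, (MeasurableEquiv.sumPiEquivProdPi _).symm
          (q.2.1, (MeasurableEquiv.funUnique Unit ℝ).symm q.2.2)))))
      = f (borderMatrix q.2.2 q.2.1 (symMatrix d q.1)) := by
    intro q
    rw [symMatrix_upperSuccEquiv]
    rfl
  refine (lintegral_congr hcomp).trans ?_
  rw [lintegral_prod _ hh.aemeasurable]
  refine lintegral_congr fun v => ?_
  exact lintegral_prod _ (hh.comp measurable_prodMk_left).aemeasurable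

/-! ### Schur complement coordinates. -/

/-- The index type of a bordered matrix, with the corner split off. -/
def finSuccEquivSum (d : ℕ) : Fin (d + 1) ≃ Fin d ⊕ Unit :=
  (finSuccEquiv d).trans (Equiv.optionEquivSumPUnit _)

/-- The block matrix `[[C, C Xᵀ], [X C, s + X C Xᵀ]]`, with Schur complement `s`. -/
def schurMatrix {d : ℕ} (s : ℝ) (X : Matrix Unit (Fin d) ℝ) (C : Matrix (Fin d) (Fin d) ℝ) :
    Matrix (Fin d ⊕ Unit) (Fin d ⊕ Unit) ℝ :=
  Matrix.fromBlocks C (C * X.transpose) (X * C) (s • 1 + X * C * X.transpose)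

/-- With border `b = C x` and corner `a = s + x ⬝ᵥ C x`, the Schur complement of `C` is `s`. -/
theorem borderMatrix_eq_schurMatrix {d : ℕ} (s : ℝ) (x : Fin d → ℝ)
    {C : Matrix (Fin d) (Fin d) ℝ} (hC : C.transpose = C) :
    borderMatrix (s + x ⬝ᵥ C.mulVec x) (C.mulVec x) C
      = (schurMatrix s (Matrix.replicateRow Unit x) C).submatrix
        (finSuccEquivSum d) (finSuccEquivSum d) := by
  have h : ∀ i, (Matrix.replicateRow Unit x * C) () i = C.mulVec x i := by
    intro i
    have hi : ∀ j, C j i = C i j := fun j => congrFun (congrFun hC i) j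
    simp [Matrix.mul_apply, Matrix.mulVec, dotProduct, mul_comm, hi]
  have h1 : finSuccEquivSum d 0 = Sum.inr () := by simp [finSuccEquivSum]
  have h2 : ∀ i : Fin d, finSuccEquivSum d i.succ = Sum.inl i := by simp [finSuccEquivSum]
  ext i j
  refine Fin.cases ?_ (fun i => ?_) i <;> refine Fin.cases ?_ (fun j => ?_) j <;>
    simp only [borderMatrix, Matrix.of_apply, Fin.cons_zero, Fin.cons_succ, Matrix.submatrix_apply,
      h1, h2, schurMatrix, Matrix.fromBlocks_apply₁₁, Matrix.fromBlocks_apply₁₂,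
      Matrix.fromBlocks_apply₂₁, Matrix.fromBlocks_apply₂₂, h]
  · simp only [Matrix.add_apply, Matrix.smul_apply, Matrix.one_apply_eq, smul_eq_mul, mul_one]
    rw [Matrix.mul_apply]
    simp only [h]
    simp [dotProduct, mul_comm]
  · simp [Matrix.mul_apply, Matrix.mulVec, dotProduct]

section

variable {d : ℕ} {C : Matrix (Fin d) (Fin d) ℝ}

theorem det_schurMatrix (hC : C.PosDef) (s : ℝ) (X : Matrix Unit (Fin d) ℝ) :
    (schurMatrix s X C).det = s * C.det := by
  have hu : IsUnit C.det := isUnit_iff_ne_zero.2 hC.det_pos.ne'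
  have := C.invertibleOfIsUnitDet hu
  rw [schurMatrix, Matrix.det_fromBlocks₁₁, Matrix.invOf_eq_nonsing_inv]
  have : s • (1 : Matrix Unit Unit ℝ) + X * C * X.transpose - X * C * C⁻¹ * (C * X.transpose)
      = s • 1 := by
    rw [Matrix.mul_assoc X C C⁻¹, Matrix.mul_nonsing_inv _ hu, Matrix.mul_one, ← Matrix.mul_assoc,
      add_sub_cancel_right]
  rw [this]
  simp [mul_comm]

/-- The Schur criterion for semidefiniteness gives `0 ≤ s`; the determinant `s * C.det` upgrades
this to the strict version. -/
theorem schurMatrix_posDef_iff (hC : C.PosDef) (s : ℝ) (X : Matrix Unit (Fin d) ℝ) :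
    (schurMatrix s X C).PosDef ↔ 0 < s := by
  have hu : IsUnit C.det := isUnit_iff_ne_zero.2 hC.det_pos.ne'
  have := C.invertibleOfIsUnitDet hu
  have ht : C.transpose = C := by
    have := hC.isHermitian
    rwa [Matrix.IsHermitian, Matrix.conjTranspose_eq_transpose_of_trivial] at this
  have h1 : schurMatrix s X C = Matrix.fromBlocks C (C * X.transpose)
      (C * X.transpose).conjTranspose (s • 1 + X * C * X.transpose) := by
    rw [Matrix.conjTranspose_eq_transpose_of_trivial, Matrix.transpose_mul, ht,
      Matrix.transpose_transpose, schurMatrix]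
  have h2 : s • (1 : Matrix Unit Unit ℝ) + X * C * X.transpose -
      (C * X.transpose).conjTranspose * C⁻¹ * (C * X.transpose) = Matrix.diagonal fun _ => s := by
    rw [Matrix.conjTranspose_eq_transpose_of_trivial, Matrix.transpose_mul, ht,
      Matrix.transpose_transpose, Matrix.mul_assoc X C C⁻¹, Matrix.mul_nonsing_inv _ hu,
      Matrix.mul_one,
      ← Matrix.mul_assoc, add_sub_cancel_right, Matrix.smul_one_eq_diagonal]
  have h3 : (schurMatrix s X C).PosSemidef ↔ 0 ≤ s := by
    rw [h1, Matrix.PosDef.fromBlocks₁₁ _ _ hC, h2, Matrix.posSemidef_diagonal_iff]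
    simp
  constructor
  · intro h
    have h4 := h.det_pos
    rw [det_schurMatrix hC] at h4
    exact pos_of_mul_pos_left h4 hC.det_pos.le
  · intro hs
    refine (h3.2 hs.le).posDef_iff_det_ne_zero.2 ?_
    rw [det_schurMatrix hC]
    exact (mul_pos hs hC.det_pos).ne'

/-- The matrix factors as unipotent times block diagonal `(C, s)` times the transposed unipotent, so
its inverse is explicit. -/
theorem trace_inv_schurMatrix (hC : C.PosDef) {s : ℝ} (hs : s ≠ 0) (X : Matrix Unit (Fin d) ℝ) :
    (schurMatrix s X C)⁻¹.trace = C⁻¹.trace + s⁻¹ * (1 + (X * X.transpose).trace) := by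
  have hu : IsUnit C.det := isUnit_iff_ne_zero.2 hC.det_pos.ne'
  have hinv : (schurMatrix s X C)⁻¹ = Matrix.fromBlocks (C⁻¹ + s⁻¹ • (X.transpose * X))
      (-(s⁻¹ • X.transpose)) (-(s⁻¹ • X)) (s⁻¹ • 1) := by
    refine Matrix.inv_eq_right_inv ?_
    rw [schurMatrix, Matrix.fromBlocks_multiply, ← Matrix.fromBlocks_one]
    congr 1
    · simp [Matrix.mul_add, Matrix.mul_assoc, Matrix.mul_nonsing_inv _ hu]
    · simp
    · simp [Matrix.mul_add, Matrix.add_mul, Matrix.mul_assoc, Matrix.mul_nonsing_inv _ hu, hs]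
    · simp [Matrix.mul_assoc, hs, smul_smul]
  have htr : ∀ (A : Matrix (Fin d) (Fin d) ℝ) (B : Matrix (Fin d) Unit ℝ)
      (B' : Matrix Unit (Fin d) ℝ) (D : Matrix Unit Unit ℝ),
      (Matrix.fromBlocks A B B' D).trace = A.trace + D.trace := by
    simp [Matrix.trace]
  rw [hinv, htr, Matrix.trace_add, Matrix.trace_smul,
    Matrix.trace_mul_comm X.transpose, Matrix.trace_smul]
  simp
  ring

end

/-! ### The inverted Wishart integral. -/

theorem borderMatrix_posDef_lower {d : ℕ} {a : ℝ} {b : Fin d → ℝ}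
    {C : Matrix (Fin d) (Fin d) ℝ} (h : (borderMatrix a b C).PosDef) : C.PosDef := by
  have := h.submatrix (Fin.succ_injective d)
  exact this

open Classical in
/-- The unnormalized isotropic inverted Wishart density `|V|^(-r) exp(-β tr(V⁻¹) / 2)`. -/
noncomputable def invWishartKernel {d : ℕ} (r β : ℝ) (V : Matrix (Fin d) (Fin d) ℝ) : ℝ :=
  if V.PosDef then V.det ^ (-r) * Real.exp (-(β / 2) * V⁻¹.trace) else 0

theorem measurable_matrix_trace (d : ℕ) :
    Measurable fun V : Matrix (Fin d) (Fin d) ℝ => V.trace :=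
  Continuous.measurable (by fun_prop)

theorem measurable_invWishartKernel {d : ℕ} (r β : ℝ) :
    Measurable (invWishartKernel r β : Matrix (Fin d) (Fin d) ℝ → ℝ) := by
  refine Measurable.ite (measurableSet_posDef d) (((measurable_matrix_det d).pow_const _).mul
    (Real.measurable_exp.comp (measurable_const.mul ?_))) measurable_const
  exact (measurable_matrix_trace d).comp (measurable_matrix_inv d)

/-- In the coordinates `(C, x, s)` the kernel is a function of `C`, times an inverse gamma factor in
`s`, times a Gaussian in `x` with variance `s / β`. -/
theorem invWishartKernel_borderMatrix {d : ℕ} (r β s : ℝ) (x : Fin d → ℝ)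
    {C : Matrix (Fin d) (Fin d) ℝ} (hC : C.PosDef) :
    invWishartKernel r β (borderMatrix (s + x ⬝ᵥ C.mulVec x) (C.mulVec x) C)
      = (Set.Ioi 0).indicator (fun s => C.det ^ (-r) * Real.exp (-(β / 2) * C⁻¹.trace) *
          (s ^ (-r) * Real.exp (-(β / 2) / s)) * Real.exp (-(β / 2 / s) * (x ⬝ᵥ x))) s := by
  have ht : C.transpose = C := by
    have := hC.isHermitian
    rwa [Matrix.IsHermitian, Matrix.conjTranspose_eq_transpose_of_trivial] at this
  have hp : (borderMatrix (s + x ⬝ᵥ C.mulVec x) (C.mulVec x) C).PosDef ↔ 0 < s := by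
    rw [← schurMatrix_posDef_iff hC s (Matrix.replicateRow Unit x),
      borderMatrix_eq_schurMatrix _ _ ht]
    refine ⟨fun h => ?_, fun h => h.submatrix (Equiv.injective _)⟩
    simpa using h.submatrix (finSuccEquivSum d).symm.injective
  by_cases hs : 0 < s
  · have hxx : (Matrix.replicateRow Unit x * (Matrix.replicateRow Unit x).transpose).trace
        = x ⬝ᵥ x := by
      simp [Matrix.trace, Matrix.mul_apply, dotProduct]
    have htr : ∀ S : Matrix (Fin d ⊕ Unit) (Fin d ⊕ Unit) ℝ,
        (S.submatrix (finSuccEquivSum d) (finSuccEquivSum d)).trace = S.trace :=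
      fun S => Equiv.sum_comp (finSuccEquivSum d) fun i => S i i
    rw [invWishartKernel, if_pos (hp.2 hs), Set.indicator_of_mem (Set.mem_Ioi.2 hs),
      borderMatrix_eq_schurMatrix _ _ ht, Matrix.det_submatrix_equiv_self,
      Matrix.inv_submatrix_equiv, htr,
      det_schurMatrix hC, trace_inv_schurMatrix hC hs.ne',
      hxx, Real.mul_rpow hs.le hC.det_pos.le]
    have : Real.exp (-(β / 2) * (C⁻¹.trace + s⁻¹ * (1 + x ⬝ᵥ x)))
        = Real.exp (-(β / 2) * C⁻¹.trace) * Real.exp (-(β / 2) / s) *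
          Real.exp (-(β / 2 / s) * (x ⬝ᵥ x)) := by
      rw [← Real.exp_add, ← Real.exp_add]
      congr 1
      field_simp
      ring
    rw [this]
    ring
  · rw [invWishartKernel, if_neg (mt hp.1 hs), Set.indicator_of_notMem (by simpa using hs)]

theorem lintegral_comp_mulVec {d : ℕ} {C : Matrix (Fin d) (Fin d) ℝ} (hC : 0 < C.det)
    {H : (Fin d → ℝ) → ENNReal} (hH : Measurable H) :
    ∫⁻ b, H b = ENNReal.ofReal C.det * ∫⁻ x, H (C.mulVec x) := by
  have h := Real.map_matrix_volume_pi_eq_smul_volume_pi hC.ne'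
  have h1 : ∫⁻ x, H (C.mulVec x) = ENNReal.ofReal C.det⁻¹ * ∫⁻ b, H b := by
    have := congrArg (fun μ => ∫⁻ b, H b ∂μ) h
    rw [lintegral_map hH (LinearMap.continuous_of_finiteDimensional _).measurable,
      lintegral_smul_measure, abs_of_pos (inv_pos.2 hC)] at this
    exact this
  rw [h1, ← mul_assoc, ← ENNReal.ofReal_mul hC.le, mul_inv_cancel₀ hC.ne', ENNReal.ofReal_one,
    one_mul]

/-- Integrating over `x` first yields a factor `s^(d/2)`, which leaves an inverse gamma integral
with shape `n / 2`. -/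
theorem lintegral_indicator_gamma_gaussian (d : ℕ) {n β : ℝ} (hn : 0 < n) (hβ : 0 < β) :
    ∫⁻ x : Fin d → ℝ, ∫⁻ s : ℝ, (Set.Ioi 0).indicator (fun s => ENNReal.ofReal
        (s ^ (-((n + d + 2) / 2)) * Real.exp (-(β / 2) / s) *
          Real.exp (-(β / 2 / s) * (x ⬝ᵥ x)))) s
      = ENNReal.ofReal (√(2 * Real.pi / β) ^ d * ((2 / β) ^ (n / 2) * Real.Gamma (n / 2))) := by
  have hm : Measurable fun q : (Fin d → ℝ) × ℝ => (Set.Ioi 0).indicator (fun s => ENNReal.ofReal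
        (s ^ (-((n + d + 2) / 2)) * Real.exp (-(β / 2) / s) *
          Real.exp (-(β / 2 / s) * (q.1 ⬝ᵥ q.1)))) q.2 := by
    have : (fun q : (Fin d → ℝ) × ℝ => (Set.Ioi 0).indicator (fun s => ENNReal.ofReal
        (s ^ (-((n + d + 2) / 2)) * Real.exp (-(β / 2) / s) *
          Real.exp (-(β / 2 / s) * (q.1 ⬝ᵥ q.1)))) q.2)
      = (Prod.snd ⁻¹' Set.Ioi 0).indicator (fun q : (Fin d → ℝ) × ℝ => ENNReal.ofReal
        (q.2 ^ (-((n + d + 2) / 2)) * Real.exp (-(β / 2) / q.2) *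
          Real.exp (-(β / 2 / q.2) * (q.1 ⬝ᵥ q.1)))) := by
      ext q
      by_cases h : 0 < q.2 <;> simp [Set.indicator, h]
    rw [this]
    refine Measurable.indicator ?_ (measurable_snd measurableSet_Ioi)
    unfold dotProduct
    fun_prop
  rw [lintegral_lintegral_swap hm.aemeasurable]
  have hs : ∀ s : ℝ, ∫⁻ x : Fin d → ℝ, (Set.Ioi 0).indicator (fun s => ENNReal.ofReal
        (s ^ (-((n + d + 2) / 2)) * Real.exp (-(β / 2) / s) *
          Real.exp (-(β / 2 / s) * (x ⬝ᵥ x)))) s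
      = (Set.Ioi 0).indicator (fun s => ENNReal.ofReal (√(2 * Real.pi / β) ^ d) *
          ENNReal.ofReal (s ^ (-(n / 2 + 1)) * Real.exp (-(β / 2) / s))) s := by
    intro s
    by_cases h : 0 < s
    · have h' : s ∈ Set.Ioi 0 := h
      simp only [Set.indicator_of_mem h']
      have hA : 0 ≤ s ^ (-((n + d + 2) / 2)) * Real.exp (-(β / 2) / s) := by positivity
      simp only [ENNReal.ofReal_mul hA]
      rw [lintegral_const_mul' _ _ ENNReal.ofReal_ne_top, lintegral_gaussian_pi d (by positivity),
        ← ENNReal.ofReal_mul hA, ← ENNReal.ofReal_mul (by positivity)]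
      congr 1
      have h1 : √(Real.pi / (β / 2 / s)) ^ d = √(2 * Real.pi / β) ^ d * s ^ ((d : ℝ) / 2) := by
        have : Real.pi / (β / 2 / s) = 2 * Real.pi / β * s := by field_simp
        rw [this, Real.sqrt_mul (by positivity), mul_pow, Real.sqrt_eq_rpow s,
          ← Real.rpow_mul_natCast h.le]
        congr 2
        ring
      have h2 : s ^ (-(n / 2 + 1)) = s ^ (-((n + d + 2) / 2)) * s ^ ((d : ℝ) / 2) := by
        rw [← Real.rpow_add h]
        congr 1
        ring
      rw [h1, h2]
      ring
    · simp [Set.indicator, h]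
  simp only [hs]
  rw [lintegral_indicator measurableSet_Ioi, lintegral_const_mul' _ _ ENNReal.ofReal_ne_top,
    lintegral_inverse_gamma (half_pos hn) (half_pos hβ), ← ENNReal.ofReal_mul (by positivity)]
  congr 4
  field_simp

theorem wishartZ_succ (n : ℝ) (d : ℕ) :
    wishartZ n (d + 1) = √Real.pi ^ d * Real.Gamma (n / 2) * wishartZ (n - 1) d := by
  have h1 : Real.pi ^ (((d + 1 : ℕ) : ℝ) * (((d + 1 : ℕ) : ℝ) - 1) / 4)
      = √Real.pi ^ d * Real.pi ^ ((d : ℝ) * ((d : ℝ) - 1) / 4) := by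
    rw [Real.sqrt_eq_rpow, ← Real.rpow_mul_natCast Real.pi_pos.le, ← Real.rpow_add Real.pi_pos]
    congr 1
    push_cast
    ring
  have h2 : ∏ i ∈ Finset.Icc 1 (d + 1), Real.Gamma ((n + 1 - (i : ℝ)) / 2)
      = Real.Gamma (n / 2) * ∏ i ∈ Finset.Icc 1 d, Real.Gamma ((n - 1 + 1 - (i : ℝ)) / 2) := by
    have key : ∀ (f : ℕ → ℝ) (k : ℕ), ∏ i ∈ Finset.Icc 1 k, f i = ∏ i ∈ Finset.range k, f (i + 1) :=
      fun f k => by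
        induction k with
        | zero => simp
        | succ k ih => rw [Finset.prod_Icc_succ_top (by omega), Finset.prod_range_succ, ih]
    rw [key, key, Finset.prod_range_succ', mul_comm]
    congr 1
    · simp
    · refine Finset.prod_congr rfl fun i _ => ?_
      congr 2
      push_cast
      ring
  rw [wishartZ, wishartZ, h1, h2]
  ring

theorem wishartZ_pos {n : ℝ} {d : ℕ} (hn : (d : ℝ) - 1 < n) : 0 < wishartZ n d := by
  refine mul_pos (Real.rpow_pos_of_pos Real.pi_pos _) (Finset.prod_pos fun i hi => ?_)
  have : (i : ℝ) ≤ d := by exact_mod_cast (Finset.mem_Icc.1 hi).2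
  exact Real.Gamma_pos_of_pos (by linarith)

/-- Induction on `d`: integrating out the border of a matrix of size `d + 1` leaves the kernel of
size `d` with `n - 1` in place of `n`, matching `wishartZ_succ`. -/
theorem lintegral_invWishartKernel (d : ℕ) {n β : ℝ} (hn : (d : ℝ) - 1 < n) (hβ : 0 < β) :
    ∫⁻ V, ENNReal.ofReal (invWishartKernel ((n + d + 1) / 2) β V) ∂(symMatrixVolume d)
      = ENNReal.ofReal ((2 / β) ^ (n * d / 2) * wishartZ n d) := by
  induction d generalizing n with
  | zero =>
    have : ∀ V : Matrix (Fin 0) (Fin 0) ℝ,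
        invWishartKernel ((n + (0 : ℕ) + 1) / 2) β V = 1 := by
      intro V
      rw [Subsingleton.elim V 1, invWishartKernel, if_pos Matrix.PosDef.one]
      simp
    simp only [this]
    rw [symMatrixVolume, lintegral_map measurable_const (measurable_symMatrix 0)]
    simp [wishartZ, volume_pi]
  | succ d ih =>
    have hn' : (d : ℝ) - 1 < n - 1 := by push_cast at hn; linarith
    have hn0 : 0 < n := by
      have : (0 : ℝ) ≤ d := d.cast_nonneg
      linarith
    set r : ℝ := (n + (d + 1 : ℕ) + 1) / 2 with hr
    have hr' : r = (n + d + 2) / 2 := by rw [hr]; push_cast; ring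
    have hf : Measurable fun V : Matrix (Fin (d + 1)) (Fin (d + 1)) ℝ =>
        ENNReal.ofReal (invWishartKernel r β V) :=
      (measurable_invWishartKernel r β).ennreal_ofReal
    rw [lintegral_symMatrixVolume_succ d hf]
    set c : ℝ := √(2 * Real.pi / β) ^ d * ((2 / β) ^ (n / 2) * Real.Gamma (n / 2)) with hc
    have hc0 : 0 < c := by
      have := Real.Gamma_pos_of_pos (half_pos hn0)
      positivity
    have key : ∀ C : Matrix (Fin d) (Fin d) ℝ,
        ∫⁻ b : Fin d → ℝ, ∫⁻ a : ℝ, ENNReal.ofReal (invWishartKernel r β (borderMatrix a b C))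
        = ENNReal.ofReal c * ENNReal.ofReal (invWishartKernel ((n - 1 + d + 1) / 2) β C) := by
      intro C
      by_cases hC : C.PosDef
      · have hmb : Measurable fun b : Fin d → ℝ =>
            ∫⁻ a : ℝ, ENNReal.ofReal (invWishartKernel r β (borderMatrix a b C)) :=
          Measurable.lintegral_prod_right' (ν := (volume : Measure ℝ))
            (f := fun q : (Fin d → ℝ) × ℝ =>
              ENNReal.ofReal (invWishartKernel r β (borderMatrix q.2 q.1 C)))
            (hf.comp ((measurable_borderMatrix d).comp measurable_prodMk_left))
        rw [lintegral_comp_mulVec hC.det_pos hmb]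
        have hx : ∀ x : Fin d → ℝ,
            ∫⁻ a : ℝ, ENNReal.ofReal (invWishartKernel r β (borderMatrix a (C.mulVec x) C))
            = ENNReal.ofReal (C.det ^ (-r) * Real.exp (-(β / 2) * C⁻¹.trace)) *
              ∫⁻ s : ℝ, (Set.Ioi 0).indicator (fun s => ENNReal.ofReal
                (s ^ (-((n + d + 2) / 2)) * Real.exp (-(β / 2) / s) *
                  Real.exp (-(β / 2 / s) * (x ⬝ᵥ x)))) s := by
          intro x
          -- For fixed `x`, passing from the corner `a` to the Schur complement `s` is a
          -- translation.
          rw [← lintegral_const_mul' _ _ ENNReal.ofReal_ne_top, ← lintegral_add_right_eq_self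
            (fun a => ENNReal.ofReal (invWishartKernel r β (borderMatrix a (C.mulVec x) C)))
            (x ⬝ᵥ C.mulVec x)]
          refine lintegral_congr fun s => ?_
          have hdet := hC.det_pos
          rw [invWishartKernel_borderMatrix r β s x hC]
          by_cases hs : 0 < s
          · have hs' : s ∈ Set.Ioi 0 := hs
            rw [Set.indicator_of_mem hs', Set.indicator_of_mem hs',
              ← ENNReal.ofReal_mul (by positivity), ← hr', mul_assoc]
          · simp [Set.indicator, hs]
        simp only [hx]
        have hdet := hC.det_pos
        rw [lintegral_const_mul' _ _ ENNReal.ofReal_ne_top,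
          lintegral_indicator_gamma_gaussian d hn0 hβ, ← hc, ← mul_assoc,
          ← ENNReal.ofReal_mul hdet.le, mul_comm, invWishartKernel, if_pos hC, ← mul_assoc]
        congr 3
        -- The Jacobian `det C` of `b = C x` turns the exponent `-r` into `1 - r = -((n - 1) + d +
        -- 1) / 2`.
        rw [← Real.rpow_one_add' hdet.le]
        · congr 1
          rw [hr']
          ring
        · rw [hr']
          have : (0 : ℝ) ≤ d := d.cast_nonneg
          intro h
          linarith
      · have h0 : ∀ a b, invWishartKernel r β (borderMatrix a b C) = 0 := fun a b =>
          if_neg fun h => hC (borderMatrix_posDef_lower h)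
        have h1 : invWishartKernel ((n - 1 + d + 1) / 2) β C = 0 := if_neg hC
        simp only [h0, h1, ENNReal.ofReal_zero, lintegral_zero, mul_zero]
    simp only [key]
    rw [lintegral_const_mul' _ _ ENNReal.ofReal_ne_top, ih hn', ← ENNReal.ofReal_mul hc0.le]
    congr 1
    rw [wishartZ_succ, hc, mul_div_right_comm, Real.sqrt_mul (by positivity), mul_pow,
      Real.sqrt_eq_rpow (2 / β), ← Real.rpow_mul_natCast (by positivity)]
    have : (2 / β) ^ (n * ((d + 1 : ℕ) : ℝ) / 2) = (2 / β) ^ (1 / 2 * (d : ℝ)) *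
        (2 / β) ^ (n / 2) * (2 / β) ^ ((n - 1) * (d : ℝ) / 2) := by
      rw [← Real.rpow_add (by positivity), ← Real.rpow_add (by positivity)]
      congr 1
      push_cast
      ring
    rw [this]
    ring

/-! ### The joint density: measurability and normalization in the standard case. -/

instance matrixSecondCountableTopology (d m : ℕ) :
    SecondCountableTopology (Matrix (Fin d) (Fin m) ℝ) :=
  inferInstanceAs (SecondCountableTopology (Fin d → Fin m → ℝ))

instance matrixVolume_sFinite (d m : ℕ) : SFinite (matrixVolume d m) := by
  unfold matrixVolume; infer_instance

instance symMatrixVolume_sFinite (d : ℕ) : SFinite (symMatrixVolume d) := by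
  unfold symMatrixVolume; infer_instance

theorem continuous_quadratic_trace {d m : ℕ} (M : Matrix (Fin d) (Fin m) ℝ)
    (K : Matrix (Fin m) (Fin m) ℝ) :
    Continuous fun q : Matrix (Fin d) (Fin m) ℝ × Matrix (Fin d) (Fin d) ℝ =>
      ((q.1 - M).transpose * q.2 * (q.1 - M) * K).trace := by
  fun_prop

theorem measurable_quadratic_trace {d m : ℕ} (M : Matrix (Fin d) (Fin m) ℝ)
    (K : Matrix (Fin m) (Fin m) ℝ) :
    Measurable fun q : Matrix (Fin d) (Fin m) ℝ × Matrix (Fin d) (Fin d) ℝ =>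
      ((q.1 - M).transpose * q.2 * (q.1 - M) * K).trace :=
  have : BorelSpace (Matrix (Fin d) (Fin m) ℝ × Matrix (Fin d) (Fin d) ℝ) := Prod.borelSpace
  (continuous_quadratic_trace M K).measurable

theorem measurable_prodMk_inv (d m : ℕ) :
    Measurable fun θ : Matrix (Fin d) (Fin m) ℝ × Matrix (Fin d) (Fin d) ℝ => (θ.1, θ.2⁻¹) :=
  measurable_fst.prodMk ((measurable_matrix_inv d).comp measurable_snd)

theorem measurable_precision_trace {d m : ℕ} (M : Matrix (Fin d) (Fin m) ℝ)
    (K : Matrix (Fin m) (Fin m) ℝ) :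
    Measurable fun θ : Matrix (Fin d) (Fin m) ℝ × Matrix (Fin d) (Fin d) ℝ =>
      ((θ.1 - M).transpose * θ.2⁻¹ * (θ.1 - M) * K).trace := by
  have := (measurable_quadratic_trace M K).comp (measurable_prodMk_inv d m)
  exact this

theorem measurable_jointDensity {d m : ℕ} (M : Matrix (Fin d) (Fin m) ℝ)
    (K : Matrix (Fin m) (Fin m) ℝ) (Q : Matrix (Fin d) (Fin d) ℝ) (n : ℝ) :
    Measurable (jointDensity M K Q n) := by
  refine Measurable.mul ?_ ?_
  · refine Measurable.mul (measurable_const.div (Measurable.pow_const ?_ _))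
      (Real.measurable_exp.comp (measurable_const.mul (measurable_precision_trace M K)))
    have : Measurable fun V : Matrix (Fin d) (Fin d) ℝ => ((2 * Real.pi) • V).det :=
      Continuous.measurable (by fun_prop)
    exact this.comp measurable_snd
  · refine Measurable.comp (g := invWishartDensity Q n) ?_ measurable_snd
    have h1 : Measurable fun V : Matrix (Fin d) (Fin d) ℝ => ((1 / 2 : ℝ) • (V⁻¹ * Q)).det :=
      Measurable.comp (g := fun W : Matrix (Fin d) (Fin d) ℝ => ((1 / 2 : ℝ) • (W * Q)).det)
        (Continuous.measurable (by fun_prop)) (measurable_matrix_inv d)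
    have h2 : Measurable fun V : Matrix (Fin d) (Fin d) ℝ => (V⁻¹ * Q).trace :=
      Measurable.comp (g := fun W : Matrix (Fin d) (Fin d) ℝ => (W * Q).trace)
        (Continuous.measurable (by fun_prop)) (measurable_matrix_inv d)
    have h3 := measurable_matrix_det d
    exact Measurable.ite (measurableSet_posDef d)
      (((measurable_const.mul (measurable_const.div (h3.pow_const _))).mul (h1.pow_const _)).mul
        (Real.measurable_exp.comp (measurable_const.mul h2))) measurable_const

/-- The unnormalized density of the joint distribution with parameters `M = 0`, `K = 1`, `Q = 1`. -/
noncomputable def jointKernel {d m : ℕ} (r β : ℝ)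
    (θ : Matrix (Fin d) (Fin m) ℝ × Matrix (Fin d) (Fin d) ℝ) : ℝ :=
  Real.exp (-(β / 2) * (θ.1.transpose * θ.2⁻¹ * θ.1).trace) * invWishartKernel r β θ.2

theorem invWishartKernel_nonneg {d : ℕ} (r β : ℝ) (V : Matrix (Fin d) (Fin d) ℝ) :
    0 ≤ invWishartKernel r β V := by
  unfold invWishartKernel
  split_ifs with h
  · have := h.det_pos
    positivity
  · exact le_rfl

theorem jointKernel_nonneg {d m : ℕ} (r β : ℝ)
    (θ : Matrix (Fin d) (Fin m) ℝ × Matrix (Fin d) (Fin d) ℝ) : 0 ≤ jointKernel r β θ :=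
  mul_nonneg (Real.exp_pos _).le (invWishartKernel_nonneg _ _ _)

theorem measurable_jointKernel {d m : ℕ} (r β : ℝ) : Measurable
    (jointKernel r β : Matrix (Fin d) (Fin m) ℝ × Matrix (Fin d) (Fin d) ℝ → ℝ) := by
  refine (Real.measurable_exp.comp (measurable_const.mul ?_)).mul
    ((measurable_invWishartKernel r β).comp measurable_snd)
  simpa using measurable_precision_trace (0 : Matrix (Fin d) (Fin m) ℝ) 1

/-- The condition `q ≠ 0` keeps the value `0` outside the positive definite cone, since `0 ^ 0 = 1`.
-/
theorem jointKernel_rpow {d m : ℕ} (r β : ℝ) {q : ℝ} (hq : q ≠ 0)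
    (θ : Matrix (Fin d) (Fin m) ℝ × Matrix (Fin d) (Fin d) ℝ) :
    jointKernel r β θ ^ q = jointKernel (q * r) (q * β) θ := by
  unfold jointKernel
  rw [Real.mul_rpow (Real.exp_pos _).le (invWishartKernel_nonneg _ _ _), ← Real.exp_mul]
  congr 1
  · congr 1
    ring
  · unfold invWishartKernel
    split_ifs with h
    · have := h.det_pos
      rw [Real.mul_rpow (by positivity) (Real.exp_pos _).le, ← Real.exp_mul,
        ← Real.rpow_mul this.le]
      congr 2 <;> ring
    · exact Real.zero_rpow hq

/-- The Gaussian integral over `A` contributes `|V|^(m/2)`, which cancels the `m` in the exponent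
and leaves the inverted Wishart kernel. -/
theorem lintegral_jointKernel (d m : ℕ) {n β : ℝ} (hn : (d : ℝ) - 1 < n) (hβ : 0 < β) :
    ∫⁻ θ, ENNReal.ofReal (jointKernel ((m + n + d + 1) / 2) β θ)
        ∂((matrixVolume d m).prod (symMatrixVolume d))
      = ENNReal.ofReal (√(Real.pi / (β / 2)) ^ (m * d) *
          ((2 / β) ^ (n * d / 2) * wishartZ n d)) := by
  rw [lintegral_prod_symm _ (measurable_jointKernel _ _).ennreal_ofReal.aemeasurable,
    ENNReal.ofReal_mul (by positivity), ← lintegral_invWishartKernel d hn hβ,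
    ← lintegral_const_mul' _ _ ENNReal.ofReal_ne_top]
  refine lintegral_congr fun V => ?_
  by_cases hV : V.PosDef
  · have hd := hV.det_pos
    simp only [jointKernel, ENNReal.ofReal_mul (Real.exp_pos _).le]
    rw [lintegral_mul_const' _ _ ENNReal.ofReal_ne_top,
      lintegral_gaussian_matrix m (half_pos hβ) hV, ← ENNReal.ofReal_mul (by positivity),
      ← ENNReal.ofReal_mul (by positivity), invWishartKernel, if_pos hV, invWishartKernel,
      if_pos hV]
    congr 1
    have : V.det ^ (-((n + d + 1) / 2))
        = V.det ^ ((m : ℝ) / 2) * V.det ^ (-((m + n + d + 1) / 2)) := by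
      rw [← Real.rpow_add hd]
      congr 1
      ring
    rw [this]
    ring
  · have h0 : ∀ r, invWishartKernel r β V = 0 := fun r => if_neg hV
    simp [jointKernel, h0]

theorem jointDensity_standard {d m : ℕ} (n : ℝ)
    (θ : Matrix (Fin d) (Fin m) ℝ × Matrix (Fin d) (Fin d) ℝ) :
    jointDensity 0 1 1 n θ = (√(Real.pi / (1 / 2)) ^ (m * d) *
      ((2 / 1) ^ (n * d / 2) * wishartZ n d))⁻¹ * jointKernel ((m + n + d + 1) / 2) 1 θ := by
  obtain ⟨A, V⟩ := θ
  unfold jointDensity jointKernel invWishartDensity invWishartKernel matrixNormalDensity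
  split_ifs with hV
  swap
  · simp
  have hd := hV.det_pos
  have hpi : 0 < 2 * Real.pi := by positivity
  simp only [sub_zero, Matrix.mul_one, Matrix.det_one, Real.one_rpow, Matrix.det_smul,
    Fintype.card_fin, Matrix.det_nonsing_inv, Ring.inverse_eq_inv', div_one]
  have h1 : ((2 * Real.pi) ^ d * V.det) ^ ((m : ℝ) / 2)
      = √(Real.pi / (1 / 2)) ^ (m * d) * V.det ^ ((m : ℝ) / 2) := by
    rw [Real.mul_rpow (by positivity) hd.le, ← Real.rpow_natCast, ← Real.rpow_mul hpi.le,
      Real.sqrt_eq_rpow, ← Real.rpow_mul_natCast (by positivity)]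
    congr 1
    rw [div_div_eq_mul_div, div_one, mul_comm Real.pi]
    congr 1
    push_cast
    ring
  have h2 : ((1 / 2 : ℝ) ^ d * V.det⁻¹) ^ (n / 2)
      = ((2 : ℝ) ^ (n * d / 2))⁻¹ * V.det ^ (-(n / 2)) := by
    rw [Real.mul_rpow (by positivity) (by positivity), ← Real.rpow_natCast, ← Real.rpow_mul
      (by norm_num), Real.inv_rpow hd.le, Real.rpow_neg hd.le, one_div, Real.inv_rpow (by norm_num)]
    congr 3
    ring
  have h3 : V.det ^ (-(((m : ℝ) + n + d + 1) / 2)) = (V.det ^ ((m : ℝ) / 2))⁻¹ *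
      (V.det ^ (((d : ℝ) + 1) / 2))⁻¹ * V.det ^ (-(n / 2)) := by
    rw [← Real.rpow_neg hd.le, ← Real.rpow_neg hd.le, ← Real.rpow_add hd, ← Real.rpow_add hd]
    congr 1
    ring
  rw [h1, h2, h3]
  simp only [mul_inv, div_eq_mul_inv, one_mul]
  ring

/-! ### Integrability of `P log P` in the standard case. -/

/-- Apply `log y ≤ y^ε / ε` to both `y = x` and `y = x⁻¹`. -/
theorem abs_mul_log_le {x ε : ℝ} (hx : 0 ≤ x) (hε : 0 < ε) (hε1 : ε < 1) :
    |x * Real.log x| ≤ (x ^ (1 + ε) + x ^ (1 - ε)) / ε := by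
  rcases hx.eq_or_lt with rfl | hx
  · rw [Real.zero_rpow (by linarith), Real.zero_rpow (by linarith)]
    simp
  have h1 := Real.log_le_rpow_div hx.le hε
  have h2 := Real.log_le_rpow_div (inv_pos.2 hx).le hε
  rw [Real.log_inv, Real.inv_rpow hx.le, ← Real.rpow_neg hx.le] at h2
  have h3 : |Real.log x| ≤ (x ^ ε + x ^ (-ε)) / ε := by
    have : 0 < x ^ ε / ε := by positivity
    have : 0 < x ^ (-ε) / ε := by positivity
    rw [add_div, abs_le]
    constructor <;> linarith
  rw [abs_mul, abs_of_pos hx, sub_eq_add_neg, Real.rpow_add hx, Real.rpow_add hx, Real.rpow_one,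
    ← mul_add, mul_div_assoc]
  exact mul_le_mul_of_nonneg_left h3 hx.le

theorem isProbDensity_standard (d m : ℕ) {n : ℝ} (hn : (d : ℝ) - 1 < n) :
    IsProbDensity ((matrixVolume d m).prod (symMatrixVolume d))
      (jointDensity (0 : Matrix (Fin d) (Fin m) ℝ) 1 1 n) := by
  have hZ := wishartZ_pos hn
  refine ⟨measurable_jointDensity _ _ _ _, fun θ => ?_, ?_⟩
  · rw [jointDensity_standard]
    exact mul_nonneg (by positivity) (jointKernel_nonneg _ _ _)
  · simp only [jointDensity_standard]
    have hk : 0 < √(Real.pi / (1 / 2)) ^ (m * d) * ((2 / 1) ^ (n * d / 2) * wishartZ n d) := by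
      positivity
    simp only [ENNReal.ofReal_mul (inv_pos.2 hk).le]
    rw [lintegral_const_mul' _ _ ENNReal.ofReal_ne_top, lintegral_jointKernel d m hn one_pos,
      ← ENNReal.ofReal_mul (inv_pos.2 hk).le, inv_mul_cancel₀ hk.ne', ENNReal.ofReal_one]

theorem integrable_jointKernel (d m : ℕ) {r β : ℝ} (hr : (m : ℝ) / 2 + d < r) (hβ : 0 < β) :
    Integrable (jointKernel r β) ((matrixVolume d m).prod (symMatrixVolume d)) := by
  refine ⟨(measurable_jointKernel r β).aestronglyMeasurable, ?_⟩
  rw [hasFiniteIntegral_iff_ofReal (.of_forall fun θ => jointKernel_nonneg _ _ _)]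
  have h := lintegral_jointKernel d m (n := 2 * r - m - d - 1) (by linarith) hβ
  have h1 : (m + (2 * r - m - d - 1) + d + 1) / 2 = r := by ring
  rw [h1] at h
  rw [h]
  exact ENNReal.ofReal_lt_top

theorem integrable_standard_mul_log (d m : ℕ) {n : ℝ} (hn : (d : ℝ) - 1 < n) :
    Integrable (fun θ => jointDensity (0 : Matrix (Fin d) (Fin m) ℝ) 1 1 n θ *
      Real.log (jointDensity (0 : Matrix (Fin d) (Fin m) ℝ) 1 1 n θ))
      ((matrixVolume d m).prod (symMatrixVolume d)) := by
  have hd0 : (0 : ℝ) ≤ d := d.cast_nonneg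
  have hm0 : (0 : ℝ) ≤ m := m.cast_nonneg
  have hpow : ∀ q : ℝ, 0 < q → (m : ℝ) / 2 + d < q * ((m + n + d + 1) / 2) →
      Integrable (fun θ => jointDensity (0 : Matrix (Fin d) (Fin m) ℝ) 1 1 n θ ^ q)
        ((matrixVolume d m).prod (symMatrixVolume d)) := by
    intro q hq hqr
    have hZ := wishartZ_pos hn
    refine ((integrable_jointKernel d m hqr (β := q * 1) (by positivity)).const_mul
      ((√(Real.pi / (1 / 2)) ^ (m * d) * ((2 / 1) ^ (n * d / 2) * wishartZ n d))⁻¹ ^ q)).congr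
      (.of_forall fun θ => ?_)
    simp only [jointDensity_standard]
    rw [Real.mul_rpow (by positivity) (jointKernel_nonneg _ _ _), jointKernel_rpow _ _ hq.ne']
  have hN : 0 < m + n + d + 1 := by linarith
  -- Integrability of the power `1 - ε` needs `ε (m + n + d + 1) < n - (d - 1)`; this `ε` uses half
  -- of that slack.
  set ε : ℝ := (n - (d - 1)) / (2 * (m + n + d + 1)) with hε
  have hεN : ε * (m + n + d + 1) = (n - (d - 1)) / 2 := by
    rw [hε]
    field_simp
  have hε0 : 0 < ε := div_pos (by linarith) (by linarith)
  have hε1 : ε < 1 := by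
    rw [hε, div_lt_one (by linarith)]
    linarith
  have hint := ((hpow (1 + ε) (by linarith) (by linarith)).add
    (hpow (1 - ε) (by linarith) (by linarith))).div_const ε
  have hmeas := measurable_jointDensity (0 : Matrix (Fin d) (Fin m) ℝ) 1 1 n
  refine hint.mono' (hmeas.mul hmeas.log).aestronglyMeasurable (.of_forall fun θ => ?_)
  exact abs_mul_log_le ((isProbDensity_standard d m hn).2.1 θ) hε0 hε1

/-! ### Entropy under a change of variables with constant Jacobian. -/

/-- Here `c` is the reciprocal of the Jacobian. Integrating `p log p` against `μ.map T` gives `c`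
times the integral of `p₀ (log c + log p₀)`, and `p₀` has mass one. -/
theorem IsProbDensity.hasEntropy_of_map {E : Type*} [MeasurableSpace E] {μ : Measure E}
    {p p₀ : E → ℝ} {T : E → E} {c h : ℝ} (hp₀ : IsProbDensity μ p₀) (hh : HasEntropy μ p₀ h)
    (hc : 0 < c) (hT : Measurable T) (hμ : μ.map T = ENNReal.ofReal c • μ)
    (hp : Measurable p) (hp0 : ∀ x, 0 ≤ p x) (hpT : ∀ x, p (T x) = c * p₀ x) :
    IsProbDensity μ p ∧ HasEntropy μ p (h - Real.log c) := by
  have hc0 : ENNReal.ofReal c ≠ 0 := (ENNReal.ofReal_pos.2 hc).ne'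
  have hint₀ : Integrable p₀ μ := by
    refine ⟨hp₀.1.aestronglyMeasurable, ?_⟩
    rw [hasFiniteIntegral_iff_ofReal (.of_forall hp₀.2.1), hp₀.2.2]
    exact ENNReal.one_lt_top
  have hmass₀ : ∫ x, p₀ x ∂μ = 1 := by
    rw [integral_eq_lintegral_of_nonneg_ae (.of_forall hp₀.2.1) hp₀.1.aestronglyMeasurable,
      hp₀.2.2, ENNReal.toReal_one]
  have hlog : ∀ x, p (T x) * Real.log (p (T x))
      = c * (Real.log c * p₀ x + p₀ x * Real.log (p₀ x)) := by
    intro x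
    rw [hpT]
    rcases eq_or_ne (p₀ x) 0 with h0 | h0
    · simp [h0]
    · rw [Real.log_mul hc.ne' h0]
      ring
  have hg : Measurable fun x => p x * Real.log (p x) := hp.mul hp.log
  have hintT : Integrable (fun x => p (T x) * Real.log (p (T x))) μ := by
    simp only [hlog]
    exact ((hint₀.const_mul _).add hh.1).const_mul c
  refine ⟨⟨hp, hp0, ?_⟩, ?_, ?_⟩
  · have h1 : ENNReal.ofReal c * ∫⁻ x, ENNReal.ofReal (p x) ∂μ = ENNReal.ofReal c * 1 := by
      rw [← smul_eq_mul, ← lintegral_smul_measure, ← hμ, lintegral_map hp.ennreal_ofReal hT]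
      simp only [hpT, ENNReal.ofReal_mul hc.le]
      rw [lintegral_const_mul' _ _ ENNReal.ofReal_ne_top, hp₀.2.2]
    exact (ENNReal.mul_right_inj hc0 ENNReal.ofReal_ne_top).1 h1
  · have h1 : Integrable (fun x => p x * Real.log (p x)) (μ.map T) :=
      (integrable_map_measure hg.aestronglyMeasurable hT.aemeasurable).2 hintT
    rw [hμ] at h1
    exact (integrable_smul_measure hc0 ENNReal.ofReal_ne_top).1 h1
  · have h1 : c * ∫ x, p x * Real.log (p x) ∂μ = c * (Real.log c - h) := by
      have h2 := integral_smul_measure (μ := μ) (fun x => p x * Real.log (p x)) (ENNReal.ofReal c)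
      rw [ENNReal.toReal_ofReal hc.le, smul_eq_mul] at h2
      rw [← h2, ← hμ, integral_map hT.aemeasurable hg.aestronglyMeasurable]
      simp only [hlog]
      rw [integral_const_mul, integral_add (hint₀.const_mul _) hh.1, integral_const_mul, hmass₀,
        ← hh.2]
      ring
    rw [mul_left_cancel₀ hc.ne' h1]
    ring

/-- The change of variables `(A, V) ↦ (L A R + M, L V Lᵀ)`. -/
def affineConj {d m : ℕ} (M : Matrix (Fin d) (Fin m) ℝ) (L : Matrix (Fin d) (Fin d) ℝ)
    (R : Matrix (Fin m) (Fin m) ℝ) : Matrix (Fin d) (Fin m) ℝ × Matrix (Fin d) (Fin d) ℝ →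
      Matrix (Fin d) (Fin m) ℝ × Matrix (Fin d) (Fin d) ℝ :=
  Prod.map (fun A => L * A * R + M) fun V => L * V * L.transpose

section

variable {d m : ℕ} {M : Matrix (Fin d) (Fin m) ℝ} {L : Matrix (Fin d) (Fin d) ℝ}
  {R : Matrix (Fin m) (Fin m) ℝ}

theorem measurable_affineConj : Measurable (affineConj M L R) :=
  (Continuous.measurable (by fun_prop)).prodMap (measurable_conj L)

theorem map_affineConj (hL : L.det ≠ 0) (hR : R.det ≠ 0) :
    ((matrixVolume d m).prod (symMatrixVolume d)).map (affineConj M L R)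
      = ENNReal.ofReal ((|L.det| ^ m * |R.det| ^ d)⁻¹ * (|L.det| ^ (d + 1))⁻¹) •
        (matrixVolume d m).prod (symMatrixVolume d) := by
  have h1 : Measurable fun A : Matrix (Fin d) (Fin m) ℝ => L * A * R + M :=
    Continuous.measurable (by fun_prop)
  rw [affineConj, ← Measure.map_prod_map _ _ h1 (measurable_conj L),
    map_affine_matrixVolume M L R hL hR, map_conj_symMatrixVolume L hL,
    Measure.prod_smul_left, Measure.prod_smul_right, smul_smul, ENNReal.ofReal_mul (by positivity)]

theorem rpow_half_sq_mul (x : ℝ) {y : ℝ} (hy : 0 ≤ y) (k : ℕ) :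
    (x * y * x) ^ ((k : ℝ) / 2) = |x| ^ k * y ^ ((k : ℝ) / 2) := by
  have : x * y * x = |x| ^ 2 * y := by
    rw [sq_abs]
    ring
  rw [this, Real.mul_rpow (by positivity) hy, ← Real.rpow_natCast_mul (abs_nonneg x)]
  push_cast
  rw [mul_div_cancel₀ _ two_ne_zero, Real.rpow_natCast]

theorem conj_posDef_iff (hL : L.det ≠ 0) (V : Matrix (Fin d) (Fin d) ℝ) :
    (L * V * L.transpose).PosDef ↔ V.PosDef := by
  have hu : IsUnit L := (Matrix.isUnit_iff_isUnit_det L).2 (isUnit_iff_ne_zero.2 hL)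
  have := Matrix.IsUnit.posDef_star_right_conjugate_iff (x := V) hu
  rwa [Matrix.star_eq_conjTranspose, Matrix.conjTranspose_eq_transpose_of_trivial] at this

/-- In the quadratic form `L` cancels against the inverse of `L V Lᵀ`, and cycling the trace brings
`R K Rᵀ = 1` together. The determinants leave the reciprocal Jacobian of `A ↦ L A R + M`. -/
theorem matrixNormalDensity_affineConj {K : Matrix (Fin m) (Fin m) ℝ} (hL : L.det ≠ 0)
    (hK : R * K * R.transpose = 1) {V : Matrix (Fin d) (Fin d) ℝ} (hV : 0 < V.det)
    (A : Matrix (Fin d) (Fin m) ℝ) :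
    matrixNormalDensity M (L * V * L.transpose) K (L * A * R + M)
      = (|L.det| ^ m * |R.det| ^ d)⁻¹ * matrixNormalDensity 0 V 1 A := by
  have hu : IsUnit L.det := isUnit_iff_ne_zero.2 hL
  have hut : IsUnit L.transpose.det := by rwa [Matrix.det_transpose]
  have hdet : R.det * K.det * R.det = 1 := by
    simpa [Matrix.det_mul] using congrArg Matrix.det hK
  have hR : R.det ≠ 0 := fun h => by simp [h] at hdet
  have hK0 : 0 ≤ K.det := by
    have h1 : K.det * (R.det * R.det) = 1 := by linarith
    have h2 : 0 < R.det * R.det := mul_self_pos.2 hR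
    exact (pos_of_mul_pos_left (h1 ▸ one_pos) h2.le).le
  have h1 : K.det ^ ((d : ℝ) / 2) = (|R.det| ^ d)⁻¹ := by
    have := rpow_half_sq_mul R.det hK0 d
    rw [hdet, Real.one_rpow] at this
    exact eq_inv_of_mul_eq_one_right this.symm
  have h2 : ((2 * Real.pi) • (L * V * L.transpose)).det ^ ((m : ℝ) / 2)
      = |L.det| ^ m * ((2 * Real.pi) • V).det ^ ((m : ℝ) / 2) := by
    rw [← rpow_half_sq_mul _ (by rw [Matrix.det_smul]; positivity)]
    congr 1
    simp only [Matrix.det_smul, Matrix.det_mul, Matrix.det_transpose]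
    ring
  have h3 : ((L * A * R + M - M).transpose * (L * V * L.transpose)⁻¹ * (L * A * R + M - M) *
      K).trace = ((A - 0).transpose * V⁻¹ * (A - 0) * 1).trace := by
    rw [add_sub_cancel_right, sub_zero, Matrix.mul_inv_rev, Matrix.mul_inv_rev,
      Matrix.transpose_mul, Matrix.transpose_mul, ← hK]
    calc _ = (R.transpose * (A.transpose * (L.transpose * L.transpose⁻¹) * V⁻¹ * (L⁻¹ * L) * A *
          R * K)).trace := by simp only [Matrix.mul_assoc]
      _ = (A.transpose * V⁻¹ * A * R * K * R.transpose).trace := by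
          rw [Matrix.mul_nonsing_inv _ hut, Matrix.nonsing_inv_mul _ hu, Matrix.trace_mul_comm]
          simp only [Matrix.mul_one]
      _ = _ := by simp only [Matrix.mul_assoc]
  rw [matrixNormalDensity, matrixNormalDensity, h1, h2, h3, Matrix.det_one, Real.one_rpow]
  simp only [mul_inv, div_eq_mul_inv, one_mul]
  ring

/-- The matrix `V⁻¹ Q` changes only by a similarity, so only the factor `|V|^(-(d+1)/2)` sees `L`.
-/
theorem invWishartDensity_affineConj (hL : L.det ≠ 0) (n : ℝ) (V : Matrix (Fin d) (Fin d) ℝ) :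
    invWishartDensity (L * L.transpose) n (L * V * L.transpose)
      = (|L.det| ^ (d + 1))⁻¹ * invWishartDensity 1 n V := by
  have hu : IsUnit L.det := isUnit_iff_ne_zero.2 hL
  have hut : IsUnit L.transpose.det := by rwa [Matrix.det_transpose]
  unfold invWishartDensity
  rw [conj_posDef_iff hL]
  split_ifs with hV
  swap
  · simp
  have h1 : (L * V * L.transpose).det ^ (((d : ℝ) + 1) / 2)
      = |L.det| ^ (d + 1) * V.det ^ (((d : ℝ) + 1) / 2) := by
    have := rpow_half_sq_mul L.det hV.det_pos.le (d + 1)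
    push_cast at this
    rw [← this, Matrix.det_mul, Matrix.det_mul, Matrix.det_transpose]
  have h2 : (L * V * L.transpose)⁻¹ * (L * L.transpose)
      = L.transpose⁻¹ * (V⁻¹ * L.transpose) := by
    rw [Matrix.mul_inv_rev, Matrix.mul_inv_rev]
    calc _ = L.transpose⁻¹ * V⁻¹ * (L⁻¹ * L) * L.transpose := by simp only [Matrix.mul_assoc]
      _ = _ := by rw [Matrix.nonsing_inv_mul _ hu, Matrix.mul_one, Matrix.mul_assoc]
  have h3 : (L.transpose⁻¹ * (V⁻¹ * L.transpose)).trace = (V⁻¹ * 1).trace := by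
    rw [Matrix.trace_mul_comm, Matrix.mul_assoc, Matrix.mul_nonsing_inv _ hut]
  have h4 : ((1 / 2 : ℝ) • (L.transpose⁻¹ * (V⁻¹ * L.transpose))).det
      = ((1 / 2 : ℝ) • (V⁻¹ * 1)).det := by
    rw [Matrix.det_smul, Matrix.det_smul, Matrix.det_mul_comm, Matrix.mul_assoc,
      Matrix.mul_nonsing_inv _ hut]
  rw [h1, h2, h3, h4]
  simp only [mul_inv, div_eq_mul_inv, one_mul]
  ring

theorem jointDensity_affineConj {K : Matrix (Fin m) (Fin m) ℝ} (hL : L.det ≠ 0)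
    (hK : R * K * R.transpose = 1) (n : ℝ)
    (θ : Matrix (Fin d) (Fin m) ℝ × Matrix (Fin d) (Fin d) ℝ) :
    jointDensity M K (L * L.transpose) n (affineConj M L R θ)
      = (|L.det| ^ m * |R.det| ^ d)⁻¹ * (|L.det| ^ (d + 1))⁻¹ * jointDensity 0 1 1 n θ := by
  unfold jointDensity affineConj
  simp only [Prod.map_fst, Prod.map_snd]
  rw [invWishartDensity_affineConj hL]
  by_cases hV : θ.2.PosDef
  · rw [matrixNormalDensity_affineConj hL hK hV.det_pos]
    ring
  · rw [invWishartDensity, if_neg hV]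
    simp

end

theorem jointDensity_nonneg {d m : ℕ} (M : Matrix (Fin d) (Fin m) ℝ)
    {K : Matrix (Fin m) (Fin m) ℝ} {Q : Matrix (Fin d) (Fin d) ℝ} (hK : K.PosDef) (hQ : Q.PosDef)
    {n : ℝ} (hn : (d : ℝ) - 1 < n) (θ : Matrix (Fin d) (Fin m) ℝ × Matrix (Fin d) (Fin d) ℝ) :
    0 ≤ jointDensity M K Q n θ := by
  unfold jointDensity invWishartDensity matrixNormalDensity
  split_ifs with hV
  · have h1 := hV.det_pos
    have h2 := hK.det_pos
    have h3 := hQ.det_pos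
    have h4 := wishartZ_pos hn
    simp only [Matrix.det_smul, Matrix.det_mul, Matrix.det_nonsing_inv, Ring.inverse_eq_inv']
    positivity
  · simp

/-! ### The entropy formula. -/

theorem lemma2 (m : ℕ) :
    ∃ f₁ : ℕ → ℝ → ℝ, ∀ (d : ℕ) (n : ℝ), (d : ℝ) - 1 < n →
      ∀ (M : Matrix (Fin d) (Fin m) ℝ) (K : Matrix (Fin m) (Fin m) ℝ)
        (Q : Matrix (Fin d) (Fin d) ℝ), K.PosDef → Q.PosDef →
        IsProbDensity ((matrixVolume d m).prod (symMatrixVolume d)) (jointDensity M K Q n) ∧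
        HasEntropy ((matrixVolume d m).prod (symMatrixVolume d)) (jointDensity M K Q n)
          (-((d : ℝ) / 2) * Real.log K.det + (((m : ℝ) + d + 1) / 2) * Real.log Q.det
            + f₁ d n) := by
  refine ⟨fun d n => -∫ θ, jointDensity (0 : Matrix (Fin d) (Fin m) ℝ) 1 1 n θ *
    Real.log (jointDensity (0 : Matrix (Fin d) (Fin m) ℝ) 1 1 n θ)
      ∂((matrixVolume d m).prod (symMatrixVolume d)), fun d n hn M K Q hK hQ => ?_⟩
  have hnn := jointDensity_nonneg M hK hQ hn
  obtain ⟨L, hL, rfl⟩ := hQ.exists_mul_transpose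
  obtain ⟨S, hS, rfl⟩ := hK.exists_mul_transpose
  have hu : IsUnit S.det := isUnit_iff_ne_zero.2 hS
  have hR : S⁻¹.det ≠ 0 := (Matrix.isUnit_nonsing_inv_det S hu).ne_zero
  have hSR : S⁻¹ * (S * S.transpose) * S⁻¹.transpose = 1 := by
    rw [← Matrix.mul_assoc, Matrix.nonsing_inv_mul _ hu, Matrix.one_mul, ← Matrix.transpose_mul,
      Matrix.nonsing_inv_mul _ hu, Matrix.transpose_one]
  have hLpos : 0 < |L.det| := abs_pos.2 hL
  have hRpos : 0 < |S⁻¹.det| := abs_pos.2 hR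
  have h := (isProbDensity_standard d m hn).hasEntropy_of_map
    ⟨integrable_standard_mul_log d m hn, rfl⟩ (by positivity) measurable_affineConj
    (map_affineConj (M := M) hL hR) (measurable_jointDensity _ _ _ _) hnn
    (jointDensity_affineConj hL hSR n)
  -- What remains is the identity between the shift by the log-Jacobian and the terms in `log |K|`
  -- and `log |Q|`.
  convert! h using 2
  have e1 : Real.log (L * L.transpose).det = 2 * Real.log |L.det| := by
    rw [Matrix.det_mul, Matrix.det_transpose, Real.log_mul hL hL, Real.log_abs]
    ring
  have e2 : Real.log (S * S.transpose).det = -2 * Real.log |S⁻¹.det| := by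
    rw [Matrix.det_mul, Matrix.det_transpose, Real.log_mul hS hS, Real.log_abs,
      Matrix.det_nonsing_inv, Ring.inverse_eq_inv', Real.log_inv]
    ring
  rw [e1, e2, Real.log_mul (by positivity) (by positivity), Real.log_inv, Real.log_inv,
    Real.log_mul (by positivity) (by positivity), Real.log_pow, Real.log_pow, Real.log_pow]
  push_cast
  ring
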